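/- Let $1/2<a\le b<1$, and let $X=\{X_n(H):n\in\mathbb N,\ H\in(1/2,1)\}$ be a centered Gaussian field such that (i) for every $M>0$, the map $(j,k,H_1,H_2)\mapsto\mathbb E[X_j(H_1)X_k(H_2)]$ is bounded on $\{(j,k)\in\mathbb N^2:|j-k|\le M\}\times[a,b]^2$; (ii) there is a continuous function $R:[a,b]^2\to(0,\infty)$ such that $$\lim_{j-k\to\infty}\ \sup_{(H_1,H_2)\in[a,b]^2}\bigl|(j-k)^{2-H_1-H_2}\,\mathbb E[X_j(H_1)X_k(H_2)]-R(H_1,H_2)\bigr|=0 .$$ Let $h:[0,\infty)\to[a,b]$ be continuous, put $\mathcal R(\theta,\sigma;H_1,H_2)=R(H_1,H_2)\mathbf 1_{\theta\ge\sigma}+R(H_2,H_1)\mathbf 1_{\theta<\sigma}$, and let $\tilde S_h=\{\tilde S_h(t)\}_{t\ge0}$ be a centered Gaussian process with covariance $$\mathbb E[\tilde S_h(t)\tilde S_h(s)]=\int_0^t d\theta\int_0^s d\sigma\ \mathcal R(\theta,\sigma;h(\theta),h(\sigma))\,|\theta-\sigma|^{h(\theta)+h(\sigma)-2},\qquad t,s\ge0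 .$$ Then: 1. $\tilde S_h$ admits a continuous modification, that is, there is a process $Y=\{Y(t)\}_{t\ge0}$ on the same probability space, all of whose paths are continuous, with $Y(t)=\tilde S_h(t)$ almost surely for every $t\ge0$. 2. If moreover $h$ is Hölder continuous on $[0,\infty)$ (that is, $|h(t)-h(s)|\le C|t-s|^{r}$ for all $s,t\ge 0$, for some $C\ge 0$ and $r>0$), then for every modification $Y$ of $\tilde S_h$ with almost surely continuous paths and for every $t_0\ge0$, the pointwise Hölder exponent of $Y$ at $t_0$, $$\alpha_{Y}(t_0)=\sup\Bigl\{\alpha\ge0:\ \lim_{t\to t_0,\ t\ne t_0,\ t\ge 0}\frac{|Y(t)-Y(t_0)|}{|t-t_0|^{\alpha}}=0\Bigr\}$$ (with values in $[0,\infty]$, and $\sup\emptyset=0$), is almost surely equal to $h(t_0)$. -/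

import Mathlib

open MeasureTheory ProbabilityTheory Filter Topology Set
open scoped NNReal ENNReal

noncomputable section

/-- A real-valued process (or field) `Z`, indexed by an arbitrary set `T`, is a centered Gaussian
process: all its finite-dimensional distributions are Gaussian and all its means vanish. -/
def IsCenteredGaussian {T Ω : Type*} [MeasurableSpace Ω] (Z : T → Ω → ℝ) (P : Measure Ω) : Prop :=
  IsGaussianProcess Z P ∧ ∀ t, ∫ ω, Z t ω ∂P = 0

/-- For every `M > 0`, the map `(j, k, H₁, H₂) ↦ 𝔼[X_j(H₁) X_k(H₂)]` is bounded on
`{|j - k| ≤ M} × [a, b]²`. -/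
def CovarianceBoundedNearDiagonal {Ω : Type*} [MeasurableSpace Ω] (a b : ℝ)
    (X : ℕ → ℝ → Ω → ℝ) (P : Measure Ω) : Prop :=
  ∀ M : ℝ, 0 < M → ∃ C : ℝ, ∀ j k : ℕ, |(j : ℝ) - (k : ℝ)| ≤ M →
    ∀ H₁ ∈ Icc a b, ∀ H₂ ∈ Icc a b, |∫ ω, X j H₁ ω * X k H₂ ω ∂P| ≤ C

/-- `R` is continuous and positive on `[a, b]²`, and, as `j - k → ∞`,
`(j - k)^(2 - H₁ - H₂) 𝔼[X_j(H₁) X_k(H₂)] → R(H₁, H₂)` uniformly in `(H₁, H₂) ∈ [a, b]²`. -/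
structure HasAsymptoticCovariance {Ω : Type*} [MeasurableSpace Ω] (a b : ℝ)
    (X : ℕ → ℝ → Ω → ℝ) (P : Measure Ω) (R : ℝ → ℝ → ℝ) : Prop where
  continuousOn : ContinuousOn (fun p : ℝ × ℝ => R p.1 p.2) (Icc a b ×ˢ Icc a b)
  pos : ∀ H₁ ∈ Icc a b, ∀ H₂ ∈ Icc a b, 0 < R H₁ H₂
  tendsto : ∀ ε : ℝ, 0 < ε → ∃ m : ℕ, ∀ j k : ℕ, k + m ≤ j →
    ∀ H₁ ∈ Icc a b, ∀ H₂ ∈ Icc a b,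
      |((j : ℝ) - (k : ℝ)) ^ (2 - H₁ - H₂) * (∫ ω, X j H₁ ω * X k H₂ ω ∂P) - R H₁ H₂| ≤ ε

/-- `𝓡(t, s; H₁, H₂) = R(H₁, H₂) 1_{t ≥ s} + R(H₂, H₁) 1_{t < s}`. -/
def orderedCov (R : ℝ → ℝ → ℝ) (t s H₁ H₂ : ℝ) : ℝ :=
  if s ≤ t then R H₁ H₂ else R H₂ H₁

/-- `𝓡*(θ, σ) = 𝓡(θ, σ; h(θ), h(σ)) |θ - σ|^(h(θ) + h(σ) - 2)`. -/
def covKernel (R : ℝ → ℝ → ℝ) (h : ℝ → ℝ) (θ σ : ℝ) : ℝ :=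
  orderedCov R θ σ (h θ) (h σ) * |θ - σ| ^ (h θ + h σ - 2)

/-- `S` is a version of the limit process with asymptotic covariance `R` and multifractional
function `h`: a centered Gaussian process on `[0, ∞)` with covariance
`𝔼[S(t) S(s)] = ∫₀ᵗ dθ ∫₀ˢ dσ 𝓡*(θ, σ)`. -/
structure IsMultifractionalLimit {Ω : Type*} [MeasurableSpace Ω] (R : ℝ → ℝ → ℝ) (h : ℝ → ℝ)
    (S : ℝ≥0 → Ω → ℝ) (P : Measure Ω) : Prop where
  isCenteredGaussian : IsCenteredGaussian S P
  covariance : ∀ t s : ℝ≥0,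
    ∫ ω, S t ω * S s ω ∂P = ∫ θ in (0 : ℝ)..t, ∫ σ in (0 : ℝ)..s, covKernel R h θ σ

/-- `Y` is a modification of `S`: at each fixed time they agree almost surely. -/
def IsModification {T Ω : Type*} [MeasurableSpace Ω] (Y S : T → Ω → ℝ) (P : Measure Ω) : Prop :=
  ∀ t, ∀ᵐ ω ∂P, Y t ω = S t ω

/-- The pointwise Hölder exponent at `t₀` of a function `f` on `[0, ∞)`, with values in `[0, ∞]`:
the supremum of all `α ≥ 0` with `|f(t) - f(t₀)| / |t - t₀|^α → 0` as `t → t₀`, `t ≠ t₀`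
(one-sided limit if `t₀ = 0`), and `0` if there is no such `α`. -/
def pointwiseHolderExponent (f : ℝ≥0 → ℝ) (t₀ : ℝ≥0) : ℝ≥0∞ :=
  ⨆ (α : ℝ≥0) (_ : Tendsto (fun t : ℝ≥0 => |f t - f t₀| / |(t : ℝ) - (t₀ : ℝ)| ^ (α : ℝ))
    (𝓝[≠] t₀) (𝓝 0)), (α : ℝ≥0∞)

end

/-! The variance of `S t - S s` is the integral of the covariance kernel over the square `(s, t]²`.
On `[a, b]²` the function `R` lies between two positive constants, so for `t - s ≤ 1` this integral
is at most a constant times `(t - s) ^ (2 * H)` if `h ≥ H > 1/2` on `[s, t]`, and at least a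
constant times the same power if `h ≤ H` there (`setIntegral_covKernel_le`,
`le_setIntegral_covKernel`).

Upper bound: Gaussian tails decay faster than any power, so for `γ < H` Borel–Cantelli bounds all
dyadic increments of a fine enough level `n` by `2 ^ (-γ n)`. Chaining (`abs_sub_le_of_sub_le`)
turns this into `γ`-Hölder continuity on the dyadic points. With `H = a` this yields the continuous
modification; with `H` just below `h t₀`, near `t₀`, it shows that the exponent is at least `h t₀`.

Lower bound: for `h t₀ < H < α`, the increment from `t₀` to `t₀ + δ` has standard deviation at least
of order `δ ^ H`, while its density is bounded by the inverse of that deviation. Hence it is below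
`δ ^ α` with probability tending to `0`, which excludes almost surely the exponent `α`. -/

/-! ### Integrals of the singular power `|θ - σ| ^ r`. -/

/-- The power `|x| ^ r` is locally integrable when `-1 < r`. -/
lemma intervalIntegrable_abs_rpow {r : ℝ} (hr : -1 < r) (a b : ℝ) :
    IntervalIntegrable (fun x : ℝ => |x| ^ r) volume a b := by
  have key : ∀ c : ℝ, 0 ≤ c → IntervalIntegrable (fun x : ℝ => |x| ^ r) volume 0 c := by
    intro c hc
    refine (intervalIntegral.intervalIntegrable_rpow' hr).congr ?_
    intro x hx
    rw [uIoc_of_le hc] at hx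
    simp only [abs_of_pos hx.1]
  have all : ∀ c : ℝ, IntervalIntegrable (fun x : ℝ => |x| ^ r) volume 0 c := by
    intro c
    rcases le_total 0 c with hc | hc
    · exact key c hc
    · rw [IntervalIntegrable.iff_comp_neg]
      simpa using key (-c) (by linarith)
  exact (all a).symm.trans (all b)

lemma integral_abs_rpow_symm {r c : ℝ} (hr : -1 < r) (hc : 0 ≤ c) :
    ∫ x in (-c)..c, |x| ^ r = 2 * c ^ (r + 1) / (r + 1) := by
  have h0 : ∫ x in (0 : ℝ)..c, |x| ^ r = c ^ (r + 1) / (r + 1) := by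
    have : ∫ x in (0 : ℝ)..c, |x| ^ r = ∫ x in (0 : ℝ)..c, x ^ r := by
      refine intervalIntegral.integral_congr fun x hx => ?_
      rw [uIcc_of_le hc] at hx
      simp only [abs_of_nonneg hx.1]
    rw [this, integral_rpow (Or.inl hr), Real.zero_rpow (by linarith), sub_zero]
  have h1 : ∫ x in (-c)..0, |x| ^ r = c ^ (r + 1) / (r + 1) := by
    have := intervalIntegral.integral_comp_neg (a := -c) (b := 0) (fun x : ℝ => |x| ^ r)
    simp only [abs_neg, neg_neg, neg_zero] at this
    rw [this, h0]
  rw [← intervalIntegral.integral_add_adjacent_intervals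
    (intervalIntegrable_abs_rpow hr _ 0) (intervalIntegrable_abs_rpow hr 0 _), h0, h1]
  ring

/-- Translating by `θ` carries `[s, t]` into `[-(t - s), t - s]`, which gives a bound independent of
`θ`. -/
lemma integral_abs_sub_rpow_le {r s t θ : ℝ} (hr : -1 < r) (hs : s ≤ θ) (ht : θ ≤ t) :
    ∫ σ in Ioc s t, |θ - σ| ^ r ≤ 2 * (t - s) ^ (r + 1) / (r + 1) := by
  rw [← intervalIntegral.integral_of_le (hs.trans ht),
    intervalIntegral.integral_comp_sub_left (fun x : ℝ => |x| ^ r) θ,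
    ← integral_abs_rpow_symm hr (by linarith : 0 ≤ t - s)]
  refine intervalIntegral.integral_mono_interval (by linarith) (by linarith) (by linarith) ?_
    (intervalIntegrable_abs_rpow hr _ _)
  exact ae_of_all _ fun x => Real.rpow_nonneg (abs_nonneg x) r

/-- On the square the integrand is `f(y) g(x - y)`, with `f` the indicator of `(0, T]` and `g` the
power cut off to `(-T, T]`. Both are integrable on the line, so the convolution integrand is
integrable on the plane. -/
lemma integrableOn_abs_sub_rpow {r : ℝ} (hr : -1 < r) (T : ℝ) :
    IntegrableOn (fun p : ℝ × ℝ => |p.1 - p.2| ^ r) (Ioc 0 T ×ˢ Ioc 0 T) := by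
  have hf : Integrable ((Ioc 0 T).indicator (fun _ => (1 : ℝ))) (volume : Measure ℝ) :=
    (integrable_indicator_iff measurableSet_Ioc).2 (by simp)
  have hg : Integrable ((Ioc (-T) T).indicator (fun x : ℝ => |x| ^ r)) volume :=
    (integrable_indicator_iff measurableSet_Ioc).2 (intervalIntegrable_abs_rpow hr (-T) T).1
  have := (hf.convolution_integrand (ContinuousLinearMap.mul ℝ ℝ) hg).integrableOn
    (s := Ioc 0 T ×ˢ Ioc 0 T)
  refine this.congr_fun ?_ (measurableSet_Ioc.prod measurableSet_Ioc)
  rintro ⟨x, y⟩ ⟨hx, hy⟩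
  simp only [mem_Ioc] at hx hy
  have : x - y ∈ Ioc (-T) T := ⟨by linarith, by linarith⟩
  simp [indicator_of_mem this, hy]

/-! ### Two-sided bounds for the covariance kernel and its integrals over squares. -/

/-- `R` is continuous with values in `[c, M]`, `0 < c`, on `[a, b]²`, and `h` is a continuous
multifractional function with values in `[a, b] ⊆ (1/2, 1)`. -/
structure IsMultifractionalData (a b c M : ℝ) (R : ℝ → ℝ → ℝ) (h : ℝ → ℝ) : Prop where
  half_lt : 1 / 2 < a
  le : a ≤ b
  lt_one : b < 1
  pos : 0 < c
  continuousOn_cov : ContinuousOn (fun p : ℝ × ℝ => R p.1 p.2) (Icc a b ×ˢ Icc a b)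
  cov_mem : ∀ H₁ ∈ Icc a b, ∀ H₂ ∈ Icc a b, R H₁ H₂ ∈ Icc c M
  continuousOn : ContinuousOn h (Ici 0)
  mem : ∀ t, 0 ≤ t → h t ∈ Icc a b

namespace IsMultifractionalData

variable {a b c M : ℝ} {R : ℝ → ℝ → ℝ} {h : ℝ → ℝ}

lemma exists_bounds (ha : 1 / 2 < a) (hab : a ≤ b) (hb : b < 1)
    (hR : ContinuousOn (fun p : ℝ × ℝ => R p.1 p.2) (Icc a b ×ˢ Icc a b))
    (hpos : ∀ H₁ ∈ Icc a b, ∀ H₂ ∈ Icc a b, 0 < R H₁ H₂)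
    (hcont : ContinuousOn h (Ici 0)) (hmem : ∀ t, 0 ≤ t → h t ∈ Icc a b) :
    ∃ c M, IsMultifractionalData a b c M R h := by
  have hK : IsCompact (Icc a b ×ˢ Icc a b) := isCompact_Icc.prod isCompact_Icc
  have hne : (Icc a b ×ˢ Icc a b).Nonempty := (nonempty_Icc.2 hab).prod (nonempty_Icc.2 hab)
  obtain ⟨p, hp, hpmin⟩ := hK.exists_isMinOn hne hR
  obtain ⟨q, -, hqmax⟩ := hK.exists_isMaxOn hne hR
  exact ⟨R p.1 p.2, R q.1 q.2, ha, hab, hb, hpos _ hp.1 _ hp.2, hR,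
    fun H₁ h₁ H₂ h₂ => ⟨hpmin (mk_mem_prod h₁ h₂), hqmax (mk_mem_prod h₁ h₂)⟩, hcont, hmem⟩

lemma bound_pos (D : IsMultifractionalData a b c M R h) : 0 < M :=
  have := D.cov_mem a ⟨le_rfl, D.le⟩ a ⟨le_rfl, D.le⟩
  D.pos.trans_le (this.1.trans this.2)

lemma orderedCov_mem (D : IsMultifractionalData a b c M R h) {θ σ : ℝ} (hθ : 0 ≤ θ) (hσ : 0 ≤ σ) :
    orderedCov R θ σ (h θ) (h σ) ∈ Icc c M := by
  unfold orderedCov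
  split_ifs
  · exact D.cov_mem _ (D.mem θ hθ) _ (D.mem σ hσ)
  · exact D.cov_mem _ (D.mem σ hσ) _ (D.mem θ hθ)

lemma exponent_lt (D : IsMultifractionalData a b c M R h) {θ σ : ℝ} (hθ : 0 ≤ θ) (hσ : 0 ≤ σ) :
    h θ + h σ - 2 < 0 := by
  have := (D.mem θ hθ).2
  have := (D.mem σ hσ).2
  have := D.lt_one
  linarith

lemma covKernel_nonneg (D : IsMultifractionalData a b c M R h) {θ σ : ℝ} (hθ : 0 ≤ θ)
    (hσ : 0 ≤ σ) : 0 ≤ covKernel R h θ σ :=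
  mul_nonneg (D.pos.le.trans (D.orderedCov_mem hθ hσ).1) (Real.rpow_nonneg (abs_nonneg _) _)

lemma covKernel_le (D : IsMultifractionalData a b c M R h) {θ σ H : ℝ} (hθ : 0 ≤ θ) (hσ : 0 ≤ σ)
    (hHθ : H ≤ h θ) (hHσ : H ≤ h σ) (hd : |θ - σ| ≤ 1) :
    covKernel R h θ σ ≤ M * |θ - σ| ^ (2 * H - 2) := by
  refine mul_le_mul (D.orderedCov_mem hθ hσ).2 ?_ (Real.rpow_nonneg (abs_nonneg _) _) D.bound_pos.le
  -- On the diagonal the kernel is `0`, because `0 ^ x = 0` for `x ≠ 0`.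
  rcases (abs_nonneg (θ - σ)).eq_or_lt with h0 | h0
  · rw [← h0, Real.zero_rpow (D.exponent_lt hθ hσ).ne]
    exact Real.rpow_nonneg le_rfl _
  · exact Real.rpow_le_rpow_of_exponent_ge h0 hd (by linarith)

/-- The diagonal has to be excluded: the kernel takes the default value `0` there. -/
lemma le_covKernel (D : IsMultifractionalData a b c M R h) {θ σ H δ : ℝ} (hθ : 0 ≤ θ) (hσ : 0 ≤ σ)
    (hne : θ ≠ σ) (hHθ : h θ ≤ H) (hHσ : h σ ≤ H) (hd : |θ - σ| ≤ δ) (hδ : δ ≤ 1) :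
    c * δ ^ (2 * H - 2) ≤ covKernel R h θ σ := by
  have h0 : 0 < |θ - σ| := abs_pos.2 (sub_ne_zero.2 hne)
  have hδ0 : 0 < δ := h0.trans_le hd
  refine mul_le_mul (D.orderedCov_mem hθ hσ).1 ?_ (Real.rpow_nonneg hδ0.le _)
    (D.pos.le.trans (D.orderedCov_mem hθ hσ).1)
  calc δ ^ (2 * H - 2) ≤ δ ^ (h θ + h σ - 2) :=
        Real.rpow_le_rpow_of_exponent_ge hδ0 hδ (by linarith)
    _ ≤ |θ - σ| ^ (h θ + h σ - 2) :=
        Real.rpow_le_rpow_of_nonpos h0 hd (D.exponent_lt hθ hσ).le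

/-- The summand `1` covers `|θ - σ| ≥ 1`; this is the integrable majorant on large squares. -/
lemma covKernel_le_add (D : IsMultifractionalData a b c M R h) {θ σ : ℝ} (hθ : 0 ≤ θ)
    (hσ : 0 ≤ σ) : covKernel R h θ σ ≤ M * (|θ - σ| ^ (2 * a - 2) + 1) := by
  rcases le_total |θ - σ| 1 with hd | hd
  · refine (D.covKernel_le hθ hσ (D.mem θ hθ).1 (D.mem σ hσ).1 hd).trans ?_
    exact mul_le_mul_of_nonneg_left (by linarith) D.bound_pos.le
  · refine mul_le_mul (D.orderedCov_mem hθ hσ).2 ?_ (Real.rpow_nonneg (abs_nonneg _) _)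
      D.bound_pos.le
    have h1 := Real.rpow_le_one_of_one_le_of_nonpos hd (D.exponent_lt hθ hσ).le
    have h2 := Real.rpow_nonneg (abs_nonneg (θ - σ)) (2 * a - 2)
    linarith

/-- Continuity is known only on `[0, ∞)` for `h` and on `[a, b]²` for `R`. Clamping the arguments
gives continuous extensions, hence a kernel measurable on the whole plane. -/
lemma exists_measurable_eq (D : IsMultifractionalData a b c M R h) :
    ∃ g : ℝ × ℝ → ℝ, Measurable g ∧ ∀ p : ℝ × ℝ, 0 ≤ p.1 → 0 ≤ p.2 →
      g p = covKernel R h p.1 p.2 := by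
  set h' : ℝ → ℝ := fun x => h (max x 0) with hh'
  have hh'c : Continuous h' :=
    D.continuousOn.comp_continuous (by fun_prop) fun x => le_max_right x 0
  set R' : ℝ × ℝ → ℝ := fun p => R (projIcc a b D.le p.1) (projIcc a b D.le p.2) with hR'
  have hR'c : Continuous R' :=
    D.continuousOn_cov.comp_continuous
      (f := fun p : ℝ × ℝ => ((projIcc a b D.le p.1 : ℝ), (projIcc a b D.le p.2 : ℝ)))
      (by fun_prop) fun p => ⟨(projIcc a b D.le p.1).2, (projIcc a b D.le p.2).2⟩
  refine ⟨fun p => (if p.2 ≤ p.1 then R' (h' p.1, h' p.2) else R' (h' p.2, h' p.1)) *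
    |p.1 - p.2| ^ (h' p.1 + h' p.2 - 2), ?_, ?_⟩
  · refine Measurable.mul (Measurable.ite (measurableSet_le measurable_snd measurable_fst)
      ?_ ?_) ?_
    · exact (by fun_prop : Continuous fun p : ℝ × ℝ => R' (h' p.1, h' p.2)).measurable
    · exact (by fun_prop : Continuous fun p : ℝ × ℝ => R' (h' p.2, h' p.1)).measurable
    · have := hh'c.measurable
      fun_prop
  · rintro ⟨x, y⟩ hx hy
    simp only at hx hy
    have hx' : h' x = h x := by simp [hh', max_eq_left hx]
    have hy' : h' y = h y := by simp [hh', max_eq_left hy]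
    have e : ∀ u ∈ Icc a b, ∀ v ∈ Icc a b, R' (u, v) = R u v := by
      intro u hu v hv
      simp only [hR', projIcc_of_mem D.le hu, projIcc_of_mem D.le hv]
    simp only [covKernel, orderedCov, hx', hy', e _ (D.mem x hx) _ (D.mem y hy),
      e _ (D.mem y hy) _ (D.mem x hx)]

lemma integrableOn_covKernel (D : IsMultifractionalData a b c M R h) (T : ℝ) :
    IntegrableOn (fun p : ℝ × ℝ => covKernel R h p.1 p.2) (Ioc 0 T ×ˢ Ioc 0 T) := by
  obtain ⟨g, hg, hgeq⟩ := D.exists_measurable_eq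
  have hm : MeasurableSet (Ioc (0 : ℝ) T ×ˢ Ioc (0 : ℝ) T) :=
    measurableSet_Ioc.prod measurableSet_Ioc
  have hone : IntegrableOn (fun _ : ℝ × ℝ => (1 : ℝ)) (Ioc 0 T ×ˢ Ioc 0 T) := by
    refine integrableOn_const ?_
    rw [Measure.volume_eq_prod, Measure.prod_prod, Real.volume_Ioc]
    exact ENNReal.mul_ne_top ENNReal.ofReal_ne_top ENNReal.ofReal_ne_top
  have hdom := ((integrableOn_abs_sub_rpow (r := 2 * a - 2)
    (by linarith [D.half_lt]) T).add hone).const_mul M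
  refine Integrable.mono' hdom ?_ ?_
  · refine hg.aestronglyMeasurable.congr ?_
    filter_upwards [ae_restrict_mem hm] with p hp
    exact hgeq p hp.1.1.le hp.2.1.le
  · filter_upwards [ae_restrict_mem hm] with p hp
    rw [Real.norm_of_nonneg (D.covKernel_nonneg hp.1.1.le hp.2.1.le)]
    exact D.covKernel_le_add hp.1.1.le hp.2.1.le

lemma integrableOn_covKernel_rect (D : IsMultifractionalData a b c M R h) {s t u v : ℝ}
    (hs : 0 ≤ s) (hu : 0 ≤ u) :
    IntegrableOn (fun p : ℝ × ℝ => covKernel R h p.1 p.2) (Ioc s t ×ˢ Ioc u v) :=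
  (D.integrableOn_covKernel (max t v)).mono_set <| prod_mono
    (Ioc_subset_Ioc hs (le_max_left _ _)) (Ioc_subset_Ioc hu (le_max_right _ _))

lemma integral_covKernel_rect (D : IsMultifractionalData a b c M R h) {s t u v : ℝ}
    (hs : 0 ≤ s) (hu : 0 ≤ u) (hst : s ≤ t) (huv : u ≤ v) :
    ∫ θ in s..t, ∫ σ in u..v, covKernel R h θ σ =
      ∫ p in Ioc s t ×ˢ Ioc u v, covKernel R h p.1 p.2 := by
  rw [intervalIntegral.integral_of_le hst, Measure.volume_eq_prod,
    setIntegral_prod _ (D.integrableOn_covKernel_rect hs hu)]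
  simp_rw [intervalIntegral.integral_of_le huv]

/-- Inclusion–exclusion for rectangles; the left side is the expansion of the variance of `S t - S
s`. -/
lemma integral_covKernel_square (D : IsMultifractionalData a b c M R h) {s t : ℝ}
    (hs : 0 ≤ s) (hst : s ≤ t) :
    ((∫ θ in (0 : ℝ)..t, ∫ σ in (0 : ℝ)..t, covKernel R h θ σ) -
      ∫ θ in (0 : ℝ)..t, ∫ σ in (0 : ℝ)..s, covKernel R h θ σ) -
      ((∫ θ in (0 : ℝ)..s, ∫ σ in (0 : ℝ)..t, covKernel R h θ σ) -
      ∫ θ in (0 : ℝ)..s, ∫ σ in (0 : ℝ)..s, covKernel R h θ σ) =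
      ∫ p in Ioc s t ×ˢ Ioc s t, covKernel R h p.1 p.2 := by
  have ht := hs.trans hst
  rw [D.integral_covKernel_rect le_rfl le_rfl ht ht, D.integral_covKernel_rect le_rfl le_rfl ht hs,
    D.integral_covKernel_rect le_rfl le_rfl hs ht, D.integral_covKernel_rect le_rfl le_rfl hs hs]
  have hm : ∀ x y u v : ℝ, MeasurableSet (Ioc x y ×ˢ Ioc u v) := fun x y u v =>
    measurableSet_Ioc.prod measurableSet_Ioc
  have hright : ∀ x : ℝ, (∫ p in Ioc 0 x ×ˢ Ioc 0 t, covKernel R h p.1 p.2) =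
      (∫ p in Ioc 0 x ×ˢ Ioc 0 s, covKernel R h p.1 p.2) +
        ∫ p in Ioc 0 x ×ˢ Ioc s t, covKernel R h p.1 p.2 := by
    intro x
    rw [← setIntegral_union ?_ (hm _ _ _ _) (D.integrableOn_covKernel_rect le_rfl le_rfl)
      (D.integrableOn_covKernel_rect le_rfl hs), ← prod_union, Ioc_union_Ioc_eq_Ioc hs hst]
    exact Disjoint.set_prod_right (Ioc_disjoint_Ioc_of_le le_rfl) _ _
  have hleft : (∫ p in Ioc 0 t ×ˢ Ioc s t, covKernel R h p.1 p.2) =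
      (∫ p in Ioc 0 s ×ˢ Ioc s t, covKernel R h p.1 p.2) +
        ∫ p in Ioc s t ×ˢ Ioc s t, covKernel R h p.1 p.2 := by
    rw [← setIntegral_union ?_ (hm _ _ _ _) (D.integrableOn_covKernel_rect le_rfl hs)
      (D.integrableOn_covKernel_rect hs hs), ← union_prod, Ioc_union_Ioc_eq_Ioc hs hst]
    exact Disjoint.set_prod_left (Ioc_disjoint_Ioc_of_le le_rfl) _ _
  rw [hright, hright, hleft]
  ring

lemma setIntegral_covKernel_le (D : IsMultifractionalData a b c M R h) {s t H : ℝ}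
    (hs : 0 ≤ s) (hst : s ≤ t) (hd : t - s ≤ 1) (hH : 1 / 2 < H)
    (hle : ∀ u ∈ Icc s t, H ≤ h u) :
    ∫ p in Ioc s t ×ˢ Ioc s t, covKernel R h p.1 p.2 ≤
      2 * M / (2 * H - 1) * (t - s) ^ (2 * H) := by
  have hm : MeasurableSet (Ioc s t ×ˢ Ioc s t) := measurableSet_Ioc.prod measurableSet_Ioc
  have hr : -1 < 2 * H - 2 := by linarith
  have hint : IntegrableOn (fun p : ℝ × ℝ => |p.1 - p.2| ^ (2 * H - 2)) (Ioc s t ×ˢ Ioc s t) :=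
    (integrableOn_abs_sub_rpow hr t).mono_set
      (prod_mono (Ioc_subset_Ioc_left hs) (Ioc_subset_Ioc_left hs))
  have h1 : ∫ p in Ioc s t ×ˢ Ioc s t, covKernel R h p.1 p.2 ≤
      ∫ p in Ioc s t ×ˢ Ioc s t, M * |p.1 - p.2| ^ (2 * H - 2) := by
    refine setIntegral_mono_on (D.integrableOn_covKernel_rect hs hs) (hint.const_mul M) hm ?_
    rintro ⟨x, y⟩ ⟨hx, hy⟩
    simp only [mem_Ioc] at hx hy
    refine D.covKernel_le (by simp; linarith) (by simp; linarith) (hle _ ⟨hx.1.le, hx.2⟩)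
      (hle _ ⟨hy.1.le, hy.2⟩) ?_
    rw [abs_le]
    constructor <;> simp only <;> linarith
  have h2 : ∫ p in Ioc s t ×ˢ Ioc s t, |p.1 - p.2| ^ (2 * H - 2) ≤
      (2 * (t - s) ^ (2 * H - 2 + 1) / (2 * H - 2 + 1)) * (t - s) := by
    rw [Measure.volume_eq_prod, setIntegral_prod _ hint]
    have hb : ∀ θ ∈ Ioc s t, ∫ σ in Ioc s t, |θ - σ| ^ (2 * H - 2) ≤
        2 * (t - s) ^ (2 * H - 2 + 1) / (2 * H - 2 + 1) := fun θ hθ =>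
      integral_abs_sub_rpow_le hr hθ.1.le hθ.2
    refine (setIntegral_mono_on (Integrable.integral_prod_left (f := fun p : ℝ × ℝ =>
      |p.1 - p.2| ^ (2 * H - 2)) ?_) (integrableOn_const (by simp)) measurableSet_Ioc hb).trans ?_
    · rw [Measure.prod_restrict]; exact hint
    · simp [hst, mul_comm]
  rw [integral_const_mul] at h1
  refine h1.trans ((mul_le_mul_of_nonneg_left h2 D.bound_pos.le).trans (le_of_eq ?_))
  have e : (t - s) ^ (2 * H) = (t - s) ^ (2 * H - 2 + 1) * (t - s) := by
    rcases hst.eq_or_lt with h0 | h0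
    · rw [h0, sub_self, mul_zero, Real.zero_rpow (by linarith)]
    · rw [← Real.rpow_add_one (by linarith : (t - s) ≠ 0)]
      congr 1
      ring
  rw [e, show 2 * H - 2 + 1 = 2 * H - 1 by ring]
  ring

/-- Off the null diagonal the kernel is at least `c * (t - s) ^ (2 * H - 2)`, and the square has
area `(t - s) ^ 2`. -/
lemma le_setIntegral_covKernel (D : IsMultifractionalData a b c M R h) {s t H : ℝ}
    (hs : 0 ≤ s) (hst : s < t) (hd : t - s ≤ 1) (hle : ∀ u ∈ Icc s t, h u ≤ H) :
    c * (t - s) ^ (2 * H) ≤ ∫ p in Ioc s t ×ˢ Ioc s t, covKernel R h p.1 p.2 := by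
  have hvol : (volume (Ioc s t)) = ENNReal.ofReal (t - s) := Real.volume_Ioc
  rw [Measure.volume_eq_prod, setIntegral_prod _ (D.integrableOn_covKernel_rect hs hs)]
  have hae : ∀ᵐ θ ∂(volume.restrict (Ioc s t)),
      c * (t - s) ^ (2 * H - 2) * (t - s) ≤ ∫ σ in Ioc s t, covKernel R h θ σ := by
    have hi : Integrable (fun p : ℝ × ℝ => covKernel R h p.1 p.2)
        ((volume.restrict (Ioc s t)).prod (volume.restrict (Ioc s t))) := by
      rw [Measure.prod_restrict]; exact D.integrableOn_covKernel_rect hs hs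
    filter_upwards [hi.prod_right_ae, ae_restrict_mem measurableSet_Ioc] with θ hθi hθ
    have : ∫ σ in Ioc s t, c * (t - s) ^ (2 * H - 2) ≤ ∫ σ in Ioc s t, covKernel R h θ σ := by
      refine integral_mono_ae (integrableOn_const (by simp)) hθi ?_
      have hne : ∀ᵐ σ ∂(volume.restrict (Ioc s t)), σ ≠ θ := by
        refine ae_restrict_of_ae ?_
        simp [ae_iff]
      filter_upwards [hne, ae_restrict_mem measurableSet_Ioc] with σ hσne hσ
      simp only [mem_Ioc] at hθ hσ
      refine D.le_covKernel (by linarith) (by linarith) hσne.symm (hle _ ⟨hθ.1.le, hθ.2⟩)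
        (hle _ ⟨hσ.1.le, hσ.2⟩) ?_ hd
      rw [abs_le]
      constructor <;> linarith
    refine le_trans (le_of_eq ?_) this
    simp [hst.le, mul_comm]
  have : ∫ θ in Ioc s t, c * (t - s) ^ (2 * H - 2) * (t - s) ≤
      ∫ θ in Ioc s t, ∫ σ in Ioc s t, covKernel R h θ σ := by
    refine integral_mono_ae (integrableOn_const (by simp)) ?_ hae
    refine Integrable.integral_prod_left (f := fun p : ℝ × ℝ => covKernel R h p.1 p.2) ?_
    rw [Measure.prod_restrict]; exact D.integrableOn_covKernel_rect hs hs
  refine le_trans (le_of_eq ?_) this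
  have e : (t - s) ^ (2 * H) = (t - s) ^ (2 * H - 2) * (t - s) * (t - s) := by
    have h0 : (t - s) ≠ 0 := by linarith
    rw [← Real.rpow_add_one h0, ← Real.rpow_add_one h0]
    congr 1
    ring
  rw [e]
  simp [hst.le]
  ring

end IsMultifractionalData

/-! ### Tail and small-ball estimates for centered Gaussian variables. -/

section Gaussian

variable {Ω : Type*} [MeasurableSpace Ω] {P : Measure Ω} {Z : Ω → ℝ}

lemma ProbabilityTheory.HasGaussianLaw.map_eq_of_integral_eq_zero (hZ : HasGaussianLaw Z P)
    (h0 : ∫ ω, Z ω ∂P = 0) : P.map Z = gaussianReal 0 (∫ ω, Z ω ^ 2 ∂P).toNNReal := by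
  rw [hZ.map_eq_gaussianReal, h0, variance_of_integral_eq_zero hZ.aemeasurable h0]

lemma ProbabilityTheory.HasGaussianLaw.hasSubgaussianMGF (hZ : HasGaussianLaw Z P) (h0 : ∫ ω, Z ω ∂P = 0)
    {v : ℝ≥0} (hv : ∫ ω, Z ω ^ 2 ∂P ≤ v) : HasSubgaussianMGF Z v P where
  integrable_exp_mul t := by
    have := integrable_exp_mul_gaussianReal (μ := 0) (v := (∫ ω, Z ω ^ 2 ∂P).toNNReal) t
    rw [← hZ.map_eq_of_integral_eq_zero h0] at this
    exact this.comp_aemeasurable hZ.aemeasurable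
  mgf_le t := by
    rw [mgf_gaussianReal (hZ.map_eq_of_integral_eq_zero h0), zero_mul, zero_add,
      Real.coe_toNNReal _ (integral_nonneg fun ω => sq_nonneg _)]
    gcongr

/-- Polynomial tail bounds of every order for a centered Gaussian variable. -/
lemma ProbabilityTheory.HasGaussianLaw.measureReal_lt_abs_le (hZ : HasGaussianLaw Z P) (h0 : ∫ ω, Z ω ∂P = 0)
    {v x : ℝ} (hv0 : 0 < v) (hv : ∫ ω, Z ω ^ 2 ∂P ≤ v) (hx : 0 < x) (p : ℕ) :
    P.real {ω | x < |Z ω|} ≤ 2 * p.factorial * (2 * v / x ^ 2) ^ p := by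
  have := hZ.isProbabilityMeasure
  have hs := hZ.hasSubgaussianMGF h0 (v := .mk v hv0.le) hv
  have h1 := hs.measure_ge_le hx.le
  have h2 := hs.neg.measure_ge_le hx.le
  rw [NNReal.coe_mk] at h1 h2
  -- This is `exp (-y) ≤ p! / y ^ p` for `y = x ^ 2 / (2 * v)`, from a single term of the
  -- exponential series.
  have hexp : Real.exp (-x ^ 2 / (2 * v)) ≤ p.factorial * (2 * v / x ^ 2) ^ p := by
    have hy : 0 < x ^ 2 / (2 * v) := by positivity
    have h3 := Real.pow_div_factorial_le_exp _ hy.le p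
    have hf : (0 : ℝ) < p.factorial := by positivity
    rw [neg_div, Real.exp_neg, show 2 * v / x ^ 2 = (x ^ 2 / (2 * v))⁻¹ by rw [inv_div], inv_pow]
    calc (Real.exp (x ^ 2 / (2 * v)))⁻¹ ≤ ((x ^ 2 / (2 * v)) ^ p / p.factorial)⁻¹ :=
          inv_anti₀ (by positivity) h3
      _ = _ := by rw [inv_div, div_eq_mul_inv]
  calc P.real {ω | x < |Z ω|} ≤ P.real ({ω | x ≤ Z ω} ∪ {ω | x ≤ (-Z) ω}) := by
        refine measureReal_mono fun ω hω => ?_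
        rw [mem_ofPred_eq] at hω
        rcases lt_abs.1 hω with h | h
        · exact mem_union_left _ h.le
        · exact mem_union_right _ h.le
    _ ≤ _ := measureReal_union_le _ _
    _ ≤ _ := by linarith

/-- A centered Gaussian variable with large variance is unlikely to be small. -/
lemma ProbabilityTheory.HasGaussianLaw.measureReal_abs_le_le (hZ : HasGaussianLaw Z P) (h0 : ∫ ω, Z ω ∂P = 0)
    {v x : ℝ} (hv0 : 0 < v) (hv : v ≤ ∫ ω, Z ω ^ 2 ∂P) (hx : 0 ≤ x) :
    P.real {ω | |Z ω| ≤ x} ≤ 2 * x / √v := by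
  have hw : (∫ ω, Z ω ^ 2 ∂P).toNNReal ≠ 0 := by
    simpa using hv0.trans_le hv
  have hset : {ω | |Z ω| ≤ x} = Z ⁻¹' Icc (-x) x := by
    ext ω; simp [abs_le]
  rw [hset, ← map_measureReal_apply_of_aemeasurable hZ.aemeasurable measurableSet_Icc,
    hZ.map_eq_of_integral_eq_zero h0, measureReal_def, gaussianReal_apply_eq_integral _ hw,
    ENNReal.toReal_ofReal (integral_nonneg fun _ => gaussianPDFReal_nonneg _ _ _)]
  -- The density is at most its value at the mean, and the factor `2π ≥ 1` is dropped.
  have hb : ∀ y : ℝ, gaussianPDFReal 0 (∫ ω, Z ω ^ 2 ∂P).toNNReal y ≤ (√v)⁻¹ := by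
    intro y
    rw [gaussianPDFReal, Real.coe_toNNReal _ (hv0.le.trans hv)]
    have h1 : Real.exp (-(y - 0) ^ 2 / (2 * ∫ ω, Z ω ^ 2 ∂P)) ≤ 1 := by
      rw [Real.exp_le_one_iff, neg_div]
      have : 0 ≤ (y - 0) ^ 2 / (2 * ∫ ω, Z ω ^ 2 ∂P) :=
        div_nonneg (sq_nonneg _) (by linarith)
      linarith
    have h2 : √v ≤ √(2 * Real.pi * ∫ ω, Z ω ^ 2 ∂P) := by
      refine Real.sqrt_le_sqrt (hv.trans ?_)
      have := Real.pi_gt_three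
      nlinarith
    calc _ ≤ (√(2 * Real.pi * ∫ ω, Z ω ^ 2 ∂P))⁻¹ * 1 := by gcongr
      _ ≤ (√v)⁻¹ := by
        rw [mul_one]
        exact inv_anti₀ (Real.sqrt_pos.2 hv0) h2
  calc _ ≤ ∫ _ in Icc (-x) x, (√v)⁻¹ :=
        setIntegral_mono_on (integrable_gaussianPDFReal _ _).integrableOn
          (integrableOn_const (by simp)) measurableSet_Icc fun y _ => hb y
    _ = _ := by
      rw [setIntegral_const, Real.volume_real_Icc_of_le (by linarith), smul_eq_mul]
      ring

end Gaussian

/-! ### Variance of the increments of the process. -/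

section Increments

variable {Ω : Type*} [MeasurableSpace Ω] {P : Measure Ω} {a b c M : ℝ} {R : ℝ → ℝ → ℝ}
  {h : ℝ → ℝ} {S : ℝ≥0 → Ω → ℝ}

namespace IsMultifractionalLimit

lemma hasGaussianLaw_sub (hS : IsMultifractionalLimit R h S P) (s t : ℝ≥0) :
    HasGaussianLaw (fun ω => S t ω - S s ω) P :=
  hS.isCenteredGaussian.1.hasGaussianLaw_fun_sub

lemma integral_sub_eq_zero (hS : IsMultifractionalLimit R h S P) (s t : ℝ≥0) :
    ∫ ω, S t ω - S s ω ∂P = 0 := by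
  rw [integral_sub (hS.isCenteredGaussian.1.hasGaussianLaw_eval t).integrable
    (hS.isCenteredGaussian.1.hasGaussianLaw_eval s).integrable, hS.isCenteredGaussian.2,
    hS.isCenteredGaussian.2, sub_zero]

lemma integral_sub_sq (hS : IsMultifractionalLimit R h S P)
    (D : IsMultifractionalData a b c M R h) {s t : ℝ≥0} (hst : s ≤ t) :
    ∫ ω, (S t ω - S s ω) ^ 2 ∂P =
      ∫ p in Ioc (s : ℝ) t ×ˢ Ioc (s : ℝ) t, covKernel R h p.1 p.2 := by
  have hL : ∀ u, MemLp (S u) 2 P := fun u =>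
    (hS.isCenteredGaussian.1.hasGaussianLaw_eval u).memLp_two
  have hi : ∀ u v, Integrable (fun ω => S u ω * S v ω) P := fun u v =>
    (hL u).integrable_mul (hL v)
  have key : ∫ ω, (S t ω - S s ω) ^ 2 ∂P = ∫ ω, ((S t ω * S t ω - S t ω * S s ω) -
      (S s ω * S t ω - S s ω * S s ω)) ∂P := integral_congr_ae (ae_of_all _ fun ω => by ring)
  rw [key, ← D.integral_covKernel_square s.coe_nonneg (NNReal.coe_le_coe.2 hst), ← hS.covariance, ← hS.covariance, ← hS.covariance,
    ← hS.covariance, integral_sub, integral_sub (hi _ _) (hi _ _), integral_sub (hi _ _) (hi _ _)]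
  · exact (hi _ _).sub (hi _ _)
  · exact (hi _ _).sub (hi _ _)

lemma integral_sub_sq_le (hS : IsMultifractionalLimit R h S P)
    (D : IsMultifractionalData a b c M R h) {s t : ℝ≥0} {H : ℝ} (hst : s ≤ t)
    (hd : (t : ℝ) - s ≤ 1) (hH : 1 / 2 < H) (hle : ∀ u ∈ Icc (s : ℝ) t, H ≤ h u) :
    ∫ ω, (S t ω - S s ω) ^ 2 ∂P ≤ 2 * M / (2 * H - 1) * ((t : ℝ) - s) ^ (2 * H) := by
  rw [hS.integral_sub_sq D hst]
  exact D.setIntegral_covKernel_le s.coe_nonneg hst hd hH hle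

lemma le_integral_sub_sq (hS : IsMultifractionalLimit R h S P)
    (D : IsMultifractionalData a b c M R h) {s t : ℝ≥0} {H : ℝ} (hst : s < t)
    (hd : (t : ℝ) - s ≤ 1) (hle : ∀ u ∈ Icc (s : ℝ) t, h u ≤ H) :
    c * ((t : ℝ) - s) ^ (2 * H) ≤ ∫ ω, (S t ω - S s ω) ^ 2 ∂P := by
  rw [hS.integral_sub_sq D hst.le]
  exact D.le_setIntegral_covKernel s.coe_nonneg hst hd hle

end IsMultifractionalLimit

end Increments

/-! ### Chaining along dyadic points. -/

section Dyadic

/-- Between `A` and `B`, the increments of `f` over neighbouring dyadic points of level `n ≥ n₀`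
are at most `r ^ n`. -/
def DyadicIncrementsLE (f : ℝ≥0 → ℝ) (A B : ℝ≥0) (r : ℝ) (n₀ : ℕ) : Prop :=
  ∀ n, n₀ ≤ n → ∀ k : ℕ, A ≤ k / 2 ^ n → ((k : ℝ≥0) + 1) / 2 ^ n ≤ B →
    |f ((k + 1) / 2 ^ n) - f (k / 2 ^ n)| ≤ r ^ n

lemma two_mul_div_two_pow_succ (k n : ℕ) :
    ((2 * k : ℕ) : ℝ≥0) / 2 ^ (n + 1) = k / 2 ^ n := by
  rw [pow_succ', Nat.cast_mul, Nat.cast_two, mul_div_mul_left _ _ two_ne_zero]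

lemma natCast_div_two_pow_eq {m n : ℕ} (hmn : m ≤ n) (k : ℕ) :
    (k : ℝ≥0) / 2 ^ m = ((k * 2 ^ (n - m) : ℕ) : ℝ≥0) / 2 ^ n := by
  rw [div_eq_div_iff (by positivity) (by positivity)]
  push_cast
  rw [mul_assoc, ← pow_add, Nat.sub_add_cancel hmn]

namespace DyadicIncrementsLE

variable {f : ℝ≥0 → ℝ} {A B : ℝ≥0} {r γ : ℝ} {n₀ : ℕ}

/-- The bound is the closed form of `r ^ n + 2 * (r ^ (n + 1) + ... + r ^ (n + d))`: each passage to
a coarser level moves both endpoints inward by at most one step of the finer mesh. -/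
lemma abs_sub_le_of_sub_le (hf : DyadicIncrementsLE f A B r n₀) (hr0 : 0 < r) (hr1 : r < 1) {n : ℕ}
    (hn : n₀ ≤ n) (d : ℕ) : ∀ k l : ℕ, k ≤ l → l ≤ k + 2 ^ d → A ≤ k / 2 ^ (n + d) →
      (l : ℝ≥0) / 2 ^ (n + d) ≤ B →
      |f (l / 2 ^ (n + d)) - f (k / 2 ^ (n + d))| ≤
        r ^ n * (1 + 2 * r / (1 - r)) - 2 * r ^ (n + d + 1) / (1 - r) := by
  have hr2 : 0 < 1 - r := by linarith
  induction d with
  | zero =>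
    intro k l hkl hlk hA hB
    have e : r ^ n * (1 + 2 * r / (1 - r)) - 2 * r ^ (n + 0 + 1) / (1 - r) = r ^ n := by
      rw [add_zero, pow_succ]; ring
    rw [e]
    rcases hkl.eq_or_lt with rfl | hlt
    · simp; positivity
    · obtain rfl : l = k + 1 := by simp at hlk; omega
      simp only [add_zero, Nat.cast_add, Nat.cast_one] at hA hB ⊢
      exact hf n hn k hA hB
  | succ d ih =>
    intro k l hkl hlk hA hB
    rw [← add_assoc] at *
    have hmono : ∀ x y : ℕ, x ≤ y → (x : ℝ≥0) / 2 ^ (n + d + 1) ≤ y / 2 ^ (n + d + 1) := by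
      intro x y hxy
      gcongr
    have hpos : 0 ≤ r ^ n * (1 + 2 * r / (1 - r)) - 2 * r ^ (n + d + 1 + 1) / (1 - r) := by
      have h1 : r ^ (n + d + 1 + 1) ≤ r ^ n * r := by
        rw [← pow_succ]
        exact pow_le_pow_of_le_one hr0.le hr1.le (by omega)
      have h2 : 2 * r ^ (n + d + 1 + 1) / (1 - r) ≤ 2 * (r ^ n * r) / (1 - r) := by gcongr
      have h3 : r ^ n * (1 + 2 * r / (1 - r)) = r ^ n + 2 * (r ^ n * r) / (1 - r) := by ring
      have h4 : 0 < r ^ n := by positivity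
      linarith
    rcases hkl.eq_or_lt with rfl | hlt
    · simpa using hpos
    -- `k'` rounds `k / 2` up and `l'` rounds `l / 2` down, so the coarser points stay between the
    -- original ones; `k < l` guarantees `k' ≤ l'`.
    set k' := (k + 1) / 2 with hk'
    set l' := l / 2 with hl'
    have hpow : 2 ^ (d + 1) = 2 * 2 ^ d := pow_succ' 2 d
    have hkl' : k' ≤ l' := by omega
    have hkA : A ≤ k' / 2 ^ (n + d) := by
      rw [← two_mul_div_two_pow_succ]
      exact hA.trans (hmono _ _ (by omega))
    have hlB : (l' : ℝ≥0) / 2 ^ (n + d) ≤ B := by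
      rw [← two_mul_div_two_pow_succ]
      exact (hmono _ _ (by omega)).trans hB
    have hmid := ih k' l' hkl' (by omega) hkA hlB
    have hleft : |f (k' / 2 ^ (n + d)) - f (k / 2 ^ (n + d + 1))| ≤ r ^ (n + d + 1) := by
      rw [← two_mul_div_two_pow_succ]
      rcases Nat.even_or_odd' k with ⟨i, hi | hi⟩
      · rw [show 2 * k' = k by omega]
        simp; positivity
      · rw [show 2 * k' = k + 1 by omega]
        push_cast
        refine hf _ (by omega) k hA (le_trans ?_ hB)
        exact_mod_cast hmono (k + 1) l hlt
    have hright : |f (l / 2 ^ (n + d + 1)) - f (l' / 2 ^ (n + d))| ≤ r ^ (n + d + 1) := by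
      rw [← two_mul_div_two_pow_succ l']
      rcases Nat.even_or_odd' l with ⟨i, hi | hi⟩
      · rw [show 2 * l' = l by omega]
        simp; positivity
      · have hl2 : (l : ℝ≥0) = (2 * l' : ℕ) + 1 := by
          exact_mod_cast (by omega : l = 2 * l' + 1)
        rw [hl2] at hB ⊢
        exact hf _ (by omega) _ (hA.trans (hmono _ _ (by omega))) hB
    have hsum : |f (l / 2 ^ (n + d + 1)) - f (k / 2 ^ (n + d + 1))| ≤
        |f (l / 2 ^ (n + d + 1)) - f (l' / 2 ^ (n + d))| +
        |f (l' / 2 ^ (n + d)) - f (k' / 2 ^ (n + d))| +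
        |f (k' / 2 ^ (n + d)) - f (k / 2 ^ (n + d + 1))| := by
      refine le_trans (le_of_eq ?_) (abs_add_three _ _ _)
      congr 1
      ring
    have hid : 2 * r ^ (n + d + 1) / (1 - r) =
        2 * r ^ (n + d + 1) + 2 * r ^ (n + d + 1 + 1) / (1 - r) := by
      field_simp
      ring
    linarith

/-- Small increments over neighbouring dyadic points make `f` Hölder continuous on the dyadic
points. -/
lemma exists_holder (hf : DyadicIncrementsLE f A B ((1 / 2 : ℝ) ^ γ) n₀) (hγ : 0 < γ) :
    ∃ C : ℝ, ∀ k l m n : ℕ, (k : ℝ≥0) / 2 ^ m ∈ Icc A B → (l : ℝ≥0) / 2 ^ n ∈ Icc A B →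
      dist ((k : ℝ≥0) / 2 ^ m) (l / 2 ^ n) ≤ (1 / 2 : ℝ) ^ n₀ →
      dist (f (k / 2 ^ m)) (f (l / 2 ^ n)) ≤ C * dist ((k : ℝ≥0) / 2 ^ m) (l / 2 ^ n) ^ γ := by
  set r : ℝ := (1 / 2 : ℝ) ^ γ with hr
  have hr0 : 0 < r := by positivity
  have hr1 : r < 1 := Real.rpow_lt_one (by norm_num) (by norm_num) hγ
  have hr2 : 0 < 1 - r := by linarith
  set C : ℝ := (1 + 2 * r / (1 - r)) * 2 ^ γ with hC
  have key : ∀ m k l : ℕ, k ≤ l → A ≤ k / 2 ^ m → (l : ℝ≥0) / 2 ^ m ≤ B →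
      ((l : ℝ) - k) / 2 ^ m ≤ (1 / 2 : ℝ) ^ n₀ →
      |f (l / 2 ^ m) - f (k / 2 ^ m)| ≤ C * (((l : ℝ) - k) / 2 ^ m) ^ γ := by
    intro m k l hkl hA hB hd
    rcases hkl.eq_or_lt with rfl | hlt
    · simp [Real.zero_rpow hγ.ne']
    have hkl1 : (k : ℝ) + 1 ≤ l := by exact_mod_cast hlt
    set δ : ℝ := ((l : ℝ) - k) / 2 ^ m with hδ
    have hδm : (1 / 2 : ℝ) ^ m ≤ δ := by
      rw [one_div, inv_pow, hδ, div_eq_mul_inv]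
      exact le_mul_of_one_le_left (by positivity) (by linarith)
    have hδ0 : 0 < δ := lt_of_lt_of_le (by positivity) hδm
    -- The level `n` satisfies `2 ^ (-(n + 1)) < δ ≤ 2 ^ (-n)`; the first inequality is the source
    -- of the factor `2 ^ γ` in `C`.
    obtain ⟨n, hn1, hn2⟩ := exists_nat_pow_near_of_lt_one hδ0
      (hd.trans (pow_le_one₀ (by norm_num) (by norm_num))) (by norm_num : (0 : ℝ) < 1 / 2)
      (by norm_num)
    have hn₀ : n₀ ≤ n := by
      by_contra hcon
      have h1 : (1 / 2 : ℝ) ^ n₀ ≤ (1 / 2 : ℝ) ^ (n + 1) :=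
        pow_le_pow_of_le_one (by norm_num) (by norm_num) (by omega)
      linarith
    have hnm : n ≤ m := by
      by_contra hcon
      have h1 : (1 / 2 : ℝ) ^ n ≤ (1 / 2 : ℝ) ^ (m + 1) :=
        pow_le_pow_of_le_one (by norm_num) (by norm_num) (by omega)
      have h2 : (1 / 2 : ℝ) ^ (m + 1) < (1 / 2 : ℝ) ^ m :=
        pow_lt_pow_right_of_lt_one₀ (by norm_num) (by norm_num) (by omega)
      linarith
    obtain ⟨d, rfl⟩ := Nat.exists_eq_add_of_le hnm
    have hlk : l ≤ k + 2 ^ d := by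
      have h1 : (l : ℝ) - k ≤ 2 ^ d := by
        rw [hδ, div_le_iff₀ (by positivity), pow_add, ← mul_assoc, ← mul_pow] at hn2
        norm_num at hn2
        linarith
      have h2 : (l : ℝ) ≤ ((k + 2 ^ d : ℕ) : ℝ) := by push_cast; linarith
      exact_mod_cast h2
    refine (hf.abs_sub_le_of_sub_le hr0 hr1 hn₀ d k l hkl hlk hA hB).trans ?_
    have h1 : r ^ n ≤ 2 ^ γ * δ ^ γ := by
      rw [hr, ← Real.rpow_natCast, ← Real.rpow_mul (by norm_num), mul_comm γ,
        Real.rpow_mul (by norm_num), Real.rpow_natCast, ← Real.mul_rpow (by norm_num) hδ0.le]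
      refine Real.rpow_le_rpow (by positivity) ?_ hγ.le
      rw [pow_succ] at hn1
      linarith
    have h2 : 0 ≤ 2 * r ^ (n + d + 1) / (1 - r) := by positivity
    have h3 : r ^ n * (1 + 2 * r / (1 - r)) ≤ 2 ^ γ * δ ^ γ * (1 + 2 * r / (1 - r)) := by gcongr
    have h4 : C * δ ^ γ = 2 ^ γ * δ ^ γ * (1 + 2 * r / (1 - r)) := by rw [hC]; ring
    linarith
  refine ⟨C, ?_⟩
  have same : ∀ m k l : ℕ, (k : ℝ≥0) / 2 ^ m ∈ Icc A B → (l : ℝ≥0) / 2 ^ m ∈ Icc A B →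
      dist ((k : ℝ≥0) / 2 ^ m) (l / 2 ^ m) ≤ (1 / 2 : ℝ) ^ n₀ →
      dist (f (k / 2 ^ m)) (f (l / 2 ^ m)) ≤ C * dist ((k : ℝ≥0) / 2 ^ m) (l / 2 ^ m) ^ γ := by
    intro m k l
    wlog hkl : k ≤ l generalizing k l
    · intro hk hl
      rw [dist_comm, dist_comm (f _)]
      exact this l k (by omega) hl hk
    intro hk hl hd
    have e : dist ((k : ℝ≥0) / 2 ^ m) (l / 2 ^ m) = ((l : ℝ) - k) / 2 ^ m := by
      have : (k : ℝ) ≤ l := by exact_mod_cast hkl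
      rw [dist_comm, NNReal.dist_eq]
      push_cast
      rw [← sub_div, abs_of_nonneg (div_nonneg (by linarith) (by positivity))]
    rw [e] at hd ⊢
    rw [dist_comm, Real.dist_eq]
    exact key m k l hkl hk.1 hl.2 hd
  -- Points of different levels are rewritten with the common denominator `2 ^ max m n`.
  intro k l m n
  have hk := natCast_div_two_pow_eq (le_max_left m n) k
  have hl := natCast_div_two_pow_eq (le_max_right m n) l
  rw [hk, hl]
  exact same _ _ _

end DyadicIncrementsLE

/-- The largest dyadic number of level `n` below `t`. -/
noncomputable def dyadicFloor (n : ℕ) (t : ℝ≥0) : ℝ≥0 := ⌊t * 2 ^ n⌋₊ / 2 ^ n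

lemma dyadicFloor_le (n : ℕ) (t : ℝ≥0) : dyadicFloor n t ≤ t := by
  rw [dyadicFloor, div_le_iff₀ (by positivity)]
  exact Nat.floor_le zero_le

lemma coe_sub_dyadicFloor_le (n : ℕ) (t : ℝ≥0) : (t : ℝ) - dyadicFloor n t ≤ (1 / 2 : ℝ) ^ n := by
  have h1 : t * 2 ^ n ≤ ⌊t * 2 ^ n⌋₊ + 1 := (Nat.lt_floor_add_one _).le
  have h2 : (t : ℝ) * 2 ^ n ≤ (⌊t * 2 ^ n⌋₊ : ℝ) + 1 := by exact_mod_cast h1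
  have h3 : (0 : ℝ) < 2 ^ n := by positivity
  rw [dyadicFloor]
  push_cast
  rw [one_div, inv_pow, sub_le_iff_le_add, ← one_div, ← add_div, le_div_iff₀ h3]
  linarith

lemma tendsto_dyadicFloor (t : ℝ≥0) : Tendsto (fun n => dyadicFloor n t) atTop (𝓝 t) := by
  rw [tendsto_iff_dist_tendsto_zero]
  refine squeeze_zero (fun _ => dist_nonneg) (fun n => ?_)
    (tendsto_pow_atTop_nhds_zero_of_lt_one (r := (1 / 2 : ℝ)) (by norm_num) (by norm_num))
  rw [dist_comm, NNReal.dist_eq,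
    abs_of_nonneg (sub_nonneg.2 (NNReal.coe_le_coe.2 (dyadicFloor_le n t)))]
  exact coe_sub_dyadicFloor_le n t

/-- The Hölder bound passes to limits along dyadic floors. The neighbourhood conditions keep these
floors in `[A, B]` eventually. -/
lemma DyadicIncrementsLE.dist_limit_le {f g : ℝ≥0 → ℝ} {A B : ℝ≥0} {γ : ℝ} {n₀ : ℕ}
    (hf : DyadicIncrementsLE f A B ((1 / 2 : ℝ) ^ γ) n₀) (hγ : 0 < γ) :
    ∃ C : ℝ, ∀ s t : ℝ≥0, Tendsto (fun n => f (dyadicFloor n s)) atTop (𝓝 (g s)) →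
      Tendsto (fun n => f (dyadicFloor n t)) atTop (𝓝 (g t)) → Icc A B ∈ 𝓝 s → Icc A B ∈ 𝓝 t →
      dist s t < (1 / 2 : ℝ) ^ n₀ → dist (g s) (g t) ≤ C * dist s t ^ γ := by
  obtain ⟨C, hC⟩ := hf.exists_holder hγ
  refine ⟨C, fun s t hs ht hsn htn hst => ?_⟩
  have hd : Tendsto (fun n => dist (dyadicFloor n s) (dyadicFloor n t)) atTop (𝓝 (dist s t)) :=
    (tendsto_dyadicFloor s).dist (tendsto_dyadicFloor t)
  refine le_of_tendsto_of_tendsto (hs.dist ht) ((hd.rpow_const (Or.inr hγ.le)).const_mul C) ?_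
  filter_upwards [tendsto_dyadicFloor s hsn, tendsto_dyadicFloor t htn, hd.eventually_lt_const hst]
    with n hn1 hn2 hn3
  exact hC _ _ _ _ hn1 hn2 hn3.le

lemma exists_continuous_limit_dyadicFloor {f : ℝ≥0 → ℝ} {γ : ℝ} (hγ : 0 < γ)
    (hf : ∀ N : ℕ, ∃ n₀, DyadicIncrementsLE f 0 N ((1 / 2 : ℝ) ^ γ) n₀) :
    ∃ g : ℝ≥0 → ℝ, Continuous g ∧
      ∀ t, Tendsto (fun n => f (dyadicFloor n t)) atTop (𝓝 (g t)) := by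
  have hnhds : ∀ t : ℝ≥0, ∃ N : ℕ, ∀ᶠ s in 𝓝 t, Icc (0 : ℝ≥0) N ∈ 𝓝 s := by
    intro t
    obtain ⟨N, hN⟩ := exists_nat_gt t
    refine ⟨N, ?_⟩
    filter_upwards [Iio_mem_nhds hN] with s hs
    filter_upwards [Iio_mem_nhds hs] with u hu
    exact ⟨zero_le, (mem_Iio.1 hu).le⟩
  have hzero : ∀ C : ℝ, Tendsto (fun x : ℝ => C * x ^ γ) (𝓝 0) (𝓝 0) := by
    intro C
    have := ((Real.continuousAt_rpow_const 0 γ (Or.inr hγ.le)).tendsto).const_mul C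
    simpa [Real.zero_rpow hγ.ne'] using this
  have hlim : ∀ t, ∃ y, Tendsto (fun n => f (dyadicFloor n t)) atTop (𝓝 y) := by
    intro t
    obtain ⟨N, hN⟩ := hnhds t
    obtain ⟨n₀, hn₀⟩ := hf N
    obtain ⟨C, hC⟩ := hn₀.exists_holder hγ
    refine cauchySeq_tendsto_of_complete ?_
    rw [cauchySeq_iff_tendsto_dist_atTop_0]
    have hcau := cauchySeq_iff_tendsto_dist_atTop_0.1 (tendsto_dyadicFloor t).cauchySeq
    have hev := (tendsto_dyadicFloor t).eventually hN.self_of_nhds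
    refine squeeze_zero' (Eventually.of_forall fun _ => dist_nonneg) ?_ ((hzero C).comp hcau)
    rw [← prod_atTop_atTop_eq] at hcau ⊢
    filter_upwards [hev.prod_inl atTop, hev.prod_inr atTop,
      hcau.eventually_lt_const (by positivity : (0 : ℝ) < (1 / 2 : ℝ) ^ n₀)] with p h1 h2 h3
    exact hC _ _ _ _ h1 h2 h3.le
  choose g hg using hlim
  refine ⟨g, continuous_iff_continuousAt.2 fun t => ?_, hg⟩
  obtain ⟨N, hN⟩ := hnhds t
  obtain ⟨n₀, hn₀⟩ := hf N
  obtain ⟨C, hC⟩ := hn₀.dist_limit_le (g := g) hγ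
  rw [ContinuousAt, tendsto_iff_dist_tendsto_zero]
  have hd : Tendsto (fun s => dist s t) (𝓝 t) (𝓝 0) := tendsto_iff_dist_tendsto_zero.1 tendsto_id
  refine squeeze_zero' (Eventually.of_forall fun _ => dist_nonneg) ?_ ((hzero C).comp hd)
  filter_upwards [hN, hd.eventually_lt_const (by positivity : (0 : ℝ) < (1 / 2 : ℝ) ^ n₀)]
    with s hs hst
  exact hC s t (hg s) (hg t) hs hN.self_of_nhds hst

end Dyadic

/-! ### Two Borel–Cantelli type statements. -/

section BorelCantelli

variable {Ω : Type*} [MeasurableSpace Ω] {P : Measure Ω}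

lemma ae_eventually_notMem_of_measureReal_le_geometric [IsFiniteMeasure P] {E : ℕ → Set Ω}
    {C q : ℝ} (hq0 : 0 ≤ q) (hq1 : q < 1) (hE : ∀ n, P.real (E n) ≤ C * q ^ n) :
    ∀ᵐ ω ∂P, ∀ᶠ n in atTop, ω ∉ E n := by
  refine ae_eventually_notMem (ne_top_of_le_ne_top
    ((summable_geometric_of_lt_one hq0 hq1).mul_left C).tsum_ofReal_ne_top
    (ENNReal.tsum_le_tsum fun n => ?_))
  rw [← ofReal_measureReal]
  exact ENNReal.ofReal_le_ofReal (hE n)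

/-- For each `N`, the intersection of the `F n` with `n ≥ N` lies in sets of arbitrarily small
measure. No independence is needed. -/
lemma ae_not_eventually_mem_of_tendsto_zero {F : ℕ → Set Ω}
    (hF : Tendsto (fun n => P (F n)) atTop (𝓝 0)) : ∀ᵐ ω ∂P, ¬ ∀ᶠ n in atTop, ω ∈ F n := by
  have h : ∀ N : ℕ, ∀ᵐ ω ∂P, ¬ ∀ n, N ≤ n → ω ∈ F n := by
    intro N
    rw [ae_iff]
    refine le_antisymm (ge_of_tendsto hF ?_) (zero_le)
    filter_upwards [eventually_ge_atTop N] with n hn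
    refine measure_mono fun ω hω => ?_
    simp only [mem_ofPred_eq, not_not] at hω
    exact hω n hn
  filter_upwards [ae_all_iff.2 h] with ω hω hev
  obtain ⟨N, hN⟩ := eventually_atTop.1 hev
  exact hω N hN

end BorelCantelli

/-! ### Dyadic increments of the process and the continuous modification. -/

namespace IsMultifractionalLimit

variable {Ω : Type*} [MeasurableSpace Ω] {P : Measure Ω} {a b c M : ℝ} {R : ℝ → ℝ → ℝ}
  {h : ℝ → ℝ} {S : ℝ≥0 → Ω → ℝ}

lemma exists_measureReal_lt_abs_sub_le (hS : IsMultifractionalLimit R h S P)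
    (D : IsMultifractionalData a b c M R h) {H γ : ℝ} (hH : 1 / 2 < H) (hγ : γ < H) :
    ∃ C : ℝ, 0 ≤ C ∧ ∀ (n : ℕ) (s t : ℝ≥0), s ≤ t → (t : ℝ) - s ≤ (1 / 2) ^ n →
      (∀ u ∈ Icc (s : ℝ) t, H ≤ h u) →
      P.real {ω | ((1 / 2 : ℝ) ^ γ) ^ n < |S t ω - S s ω|} ≤ C * (1 / 4) ^ n := by
  -- With `x = 2 ^ (-n)` the tail bound of order `p` is a constant times `x ^ (2 * (H - γ) * p)`;
  -- this `p` makes it at most a constant times `x ^ 2 = 4 ^ (-n)`.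
  obtain ⟨p, hp⟩ := exists_nat_gt (1 / (H - γ))
  have hHγ : 0 < H - γ := by linarith
  have hp1 : 1 ≤ (H - γ) * p := by
    rw [div_lt_iff₀ hHγ] at hp
    linarith
  set K : ℝ := 2 * M / (2 * H - 1) with hK
  have hK0 : 0 < K := div_pos (by linarith [D.bound_pos]) (by linarith)
  refine ⟨2 * p.factorial * (2 * K) ^ p, by positivity, fun n s t hst hd hle => ?_⟩
  set x : ℝ := (1 / 2 : ℝ) ^ n with hx
  have hx0 : 0 < x := by positivity
  have hx1 : x ≤ 1 := pow_le_one₀ (by norm_num) (by norm_num)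
  have hv : ∫ ω, (S t ω - S s ω) ^ 2 ∂P ≤ K * x ^ (2 * H) := by
    refine (hS.integral_sub_sq_le D hst (hd.trans hx1) hH hle).trans ?_
    refine mul_le_mul_of_nonneg_left (Real.rpow_le_rpow ?_ hd (by linarith)) hK0.le
    exact sub_nonneg.2 (NNReal.coe_le_coe.2 hst)
  have hxγ : ((1 / 2 : ℝ) ^ γ) ^ n = x ^ γ := by
    rw [hx, ← Real.rpow_natCast, ← Real.rpow_natCast, ← Real.rpow_mul (by norm_num),
      ← Real.rpow_mul (by norm_num), mul_comm]
  rw [hxγ]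
  refine ((hS.hasGaussianLaw_sub s t).measureReal_lt_abs_le (hS.integral_sub_eq_zero s t)
    (by positivity) hv (by positivity) p).trans ?_
  have e1 : 2 * (K * x ^ (2 * H)) / (x ^ γ) ^ 2 = 2 * K * x ^ (2 * (H - γ)) := by
    rw [← Real.rpow_natCast (x ^ γ) 2, ← Real.rpow_mul hx0.le, ← mul_assoc, mul_div_assoc,
      ← Real.rpow_sub hx0]
    congr 2
    push_cast
    ring
  have e2 : (x ^ (2 * (H - γ))) ^ p ≤ (1 / 4) ^ n := by
    rw [← Real.rpow_natCast (x ^ (2 * (H - γ))) p, ← Real.rpow_mul hx0.le]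
    calc x ^ (2 * (H - γ) * p) ≤ x ^ (2 : ℝ) :=
          Real.rpow_le_rpow_of_exponent_ge hx0 hx1 (by linarith)
      _ = (1 / 4) ^ n := by
          rw [Real.rpow_two, hx, ← pow_mul, mul_comm, pow_mul]
          norm_num
  rw [e1, mul_pow, ← mul_assoc]
  exact mul_le_mul_of_nonneg_left e2 (by positivity)

lemma ae_exists_dyadicIncrementsLE [IsFiniteMeasure P] (hS : IsMultifractionalLimit R h S P)
    (D : IsMultifractionalData a b c M R h) {H γ : ℝ} (hH : 1 / 2 < H) (hγ : γ < H)
    {A B : ℝ≥0} (hle : ∀ u ∈ Icc A B, H ≤ h u) :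
    ∀ᵐ ω ∂P, ∃ n₀, DyadicIncrementsLE (fun t => S t ω) A B ((1 / 2 : ℝ) ^ γ) n₀ := by
  obtain ⟨C, hC0, hC⟩ := hS.exists_measureReal_lt_abs_sub_le D hH hγ
  obtain ⟨N, hN⟩ := exists_nat_ge B
  set F : ℕ → ℕ → Set Ω := fun n k => {ω | A ≤ k / 2 ^ n ∧ ((k : ℝ≥0) + 1) / 2 ^ n ≤ B ∧
    ((1 / 2 : ℝ) ^ γ) ^ n < |S ((k + 1) / 2 ^ n) ω - S (k / 2 ^ n) ω|} with hF
  have hFle : ∀ n k, P.real (F n k) ≤ C * (1 / 4) ^ n := by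
    intro n k
    by_cases hk : A ≤ k / 2 ^ n ∧ ((k : ℝ≥0) + 1) / 2 ^ n ≤ B
    · have hst : (k : ℝ≥0) / 2 ^ n ≤ (k + 1) / 2 ^ n := by gcongr; simp
      refine (measureReal_mono fun ω hω => ?_).trans (hC n (k / 2 ^ n) ((k + 1) / 2 ^ n) hst ?_ ?_)
      · exact hω.2.2
      · push_cast
        rw [← sub_div, add_sub_cancel_left, one_div, one_div, inv_pow]
      · intro u hu
        lift u to ℝ≥0 using (NNReal.coe_nonneg _).trans hu.1
        exact hle u ⟨hk.1.trans (NNReal.coe_le_coe.1 hu.1), (NNReal.coe_le_coe.1 hu.2).trans hk.2⟩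
    · have : F n k = ∅ := by
        ext ω
        simp only [hF, mem_ofPred_eq, mem_empty_iff_false, iff_false]
        exact fun hω => hk ⟨hω.1, hω.2.1⟩
      rw [this]
      simp
      positivity
  set E : ℕ → Set Ω := fun n => ⋃ k ∈ Finset.range (N * 2 ^ n), F n k with hE
  -- Level `n` has at most `N * 2 ^ n` intervals, which leaves the summable bound `2 ^ (-n)` out of
  -- `4 ^ (-n)`.
  have hEle : ∀ n, P.real (E n) ≤ N * C * (1 / 2) ^ n := by
    intro n
    calc P.real (E n) ≤ ∑ k ∈ Finset.range (N * 2 ^ n), P.real (F n k) :=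
          measureReal_biUnion_finset_le _ _
      _ ≤ ∑ k ∈ Finset.range (N * 2 ^ n), C * (1 / 4) ^ n := Finset.sum_le_sum fun k _ => hFle n k
      _ = N * C * (2 ^ n * (1 / 4) ^ n) := by simp; ring
      _ = N * C * (1 / 2) ^ n := by rw [← mul_pow]; norm_num
  filter_upwards [ae_eventually_notMem_of_measureReal_le_geometric (by norm_num) (by norm_num) hEle]
    with ω hω
  obtain ⟨n₀, hn₀⟩ := eventually_atTop.1 hω
  refine ⟨n₀, fun n hn k hA hB => ?_⟩
  by_contra! hcon
  refine hn₀ n hn (mem_iUnion₂.2 ⟨k, ?_, hA, hB, hcon⟩)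
  have h1 : ((k : ℝ≥0) + 1) ≤ N * 2 ^ n := (div_le_iff₀ (by positivity)).1 (hB.trans hN)
  have h2 : k + 1 ≤ N * 2 ^ n := by exact_mod_cast h1
  exact Finset.mem_range.2 h2

lemma ae_tendsto_dyadicFloor [IsFiniteMeasure P] (hS : IsMultifractionalLimit R h S P)
    (D : IsMultifractionalData a b c M R h) (t : ℝ≥0) :
    ∀ᵐ ω ∂P, Tendsto (fun n => S (dyadicFloor n t) ω) atTop (𝓝 (S t ω)) := by
  have ha := D.half_lt
  obtain ⟨C, hC0, hC⟩ := hS.exists_measureReal_lt_abs_sub_le D ha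
    (show (1 / 2 : ℝ) < a from ha)
  have hE := fun n => hC n (dyadicFloor n t) t (dyadicFloor_le n t) (coe_sub_dyadicFloor_le n t)
    fun u hu => (D.mem u ((NNReal.coe_nonneg _).trans hu.1)).1
  filter_upwards [ae_eventually_notMem_of_measureReal_le_geometric (by norm_num) (by norm_num) hE]
    with ω hω
  rw [tendsto_iff_dist_tendsto_zero]
  refine squeeze_zero' (Eventually.of_forall fun _ => dist_nonneg) ?_
    (tendsto_pow_atTop_nhds_zero_of_lt_one (r := (1 / 2 : ℝ) ^ (1 / 2 : ℝ)) (by positivity)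
      (Real.rpow_lt_one (by norm_num) (by norm_num) (by norm_num)))
  filter_upwards [hω] with n hn
  rw [dist_comm, Real.dist_eq]
  simpa using hn

theorem exists_continuous_modification [IsFiniteMeasure P] (hS : IsMultifractionalLimit R h S P)
    (D : IsMultifractionalData a b c M R h) :
    ∃ Y : ℝ≥0 → Ω → ℝ, (∀ t, Measurable (Y t)) ∧ IsModification Y S P ∧
      ∀ ω, Continuous fun t => Y t ω := by
  have hae : ∀ t, AEMeasurable (S t) P := hS.isCenteredGaussian.1.aemeasurable
  -- The variables `S t` are only a.e. measurable; measurable versions make the good event `G` and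
  -- the limit `Y t` measurable.
  set S' : ℝ≥0 → Ω → ℝ := fun t => (hae t).mk (S t) with hS'
  have hS'm : ∀ t, Measurable (S' t) := fun t => (hae t).measurable_mk
  have hS'eq : ∀ t, ∀ᵐ ω ∂P, S t ω = S' t ω := fun t => (hae t).ae_eq_mk
  set r : ℝ := (1 / 2 : ℝ) ^ (1 / 2 : ℝ) with hr
  set G : Set Ω := {ω | ∀ N : ℕ, ∃ n₀, DyadicIncrementsLE (fun t => S' t ω) 0 N r n₀} with hG
  have hGm : MeasurableSet G := by
    have : G = ⋂ N : ℕ, ⋃ n₀ : ℕ, ⋂ n : ℕ, ⋂ (_ : n₀ ≤ n), ⋂ k : ℕ,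
        ⋂ (_ : (0 : ℝ≥0) ≤ k / 2 ^ n), ⋂ (_ : ((k : ℝ≥0) + 1) / 2 ^ n ≤ N),
        {ω | |S' ((k + 1) / 2 ^ n) ω - S' (k / 2 ^ n) ω| ≤ r ^ n} := by
      ext ω
      simp only [hG, DyadicIncrementsLE, mem_ofPred_eq, mem_iInter, mem_iUnion]
    rw [this]
    refine MeasurableSet.iInter fun N => MeasurableSet.iUnion fun n₀ => MeasurableSet.iInter fun n =>
      MeasurableSet.iInter fun _ => MeasurableSet.iInter fun k => MeasurableSet.iInter fun _ =>
      MeasurableSet.iInter fun _ => ?_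
    exact measurableSet_le ((hS'm _).sub (hS'm _)).abs measurable_const
  have hGae : ∀ᵐ ω ∂P, ω ∈ G := by
    have h1 : ∀ᵐ ω ∂P, ∀ N : ℕ, ∃ n₀, DyadicIncrementsLE (fun t => S t ω) 0 N r n₀ :=
      ae_all_iff.2 fun N => hS.ae_exists_dyadicIncrementsLE D D.half_lt D.half_lt
        fun u _ => (D.mem u u.coe_nonneg).1
    have h2 : ∀ᵐ ω ∂P, ∀ n k : ℕ, S (k / 2 ^ n) ω = S' (k / 2 ^ n) ω :=
      ae_all_iff.2 fun n => ae_all_iff.2 fun k => hS'eq _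
    filter_upwards [h1, h2] with ω h1 h2 N
    obtain ⟨n₀, hn₀⟩ := h1 N
    refine ⟨n₀, fun n hn k hA hB => ?_⟩
    have h3 := h2 n (k + 1)
    push_cast at h3
    simp only [← h2 n k, ← h3]
    exact hn₀ n hn k hA hB
  -- Cutting off to `0` outside `G` makes every path continuous, not just almost every one.
  have hlim : ∀ ω, ∃ g : ℝ≥0 → ℝ, Continuous g ∧
      ∀ t, Tendsto (fun n => G.indicator (S' (dyadicFloor n t)) ω) atTop (𝓝 (g t)) := by
    intro ω
    by_cases hω : ω ∈ G
    · simp only [indicator_of_mem hω]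
      exact exists_continuous_limit_dyadicFloor (f := fun t => S' t ω) (by norm_num) hω
    · simp only [indicator_of_notMem hω]
      exact ⟨fun _ => 0, continuous_const, fun _ => tendsto_const_nhds⟩
  choose g hgc hg using hlim
  refine ⟨fun t ω => g ω t, fun t => ?_, fun t => ?_, hgc⟩
  · refine measurable_of_tendsto_metrizable (f := fun n => G.indicator (S' (dyadicFloor n t)))
      (fun n => (hS'm _).indicator hGm) ?_
    exact tendsto_pi_nhds.2 fun ω => hg ω t
  · filter_upwards [hGae, hS.ae_tendsto_dyadicFloor D t,
      ae_all_iff.2 fun n => hS'eq (dyadicFloor n t)] with ω h1 h2 h3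
    have h4 := hg ω t
    simp only [indicator_of_mem h1, ← h3] at h4
    exact tendsto_nhds_unique h4 h2

end IsMultifractionalLimit

/-! ### Deterministic criteria for the pointwise Hölder exponent. -/

section HolderExponent

lemma tendsto_div_rpow_of_le {f : ℝ≥0 → ℝ} {t₀ : ℝ≥0} {α β : ℝ} (hαβ : α ≤ β)
    (hβ : Tendsto (fun t : ℝ≥0 => |f t - f t₀| / |(t : ℝ) - (t₀ : ℝ)| ^ β) (𝓝[≠] t₀) (𝓝 0)) :
    Tendsto (fun t : ℝ≥0 => |f t - f t₀| / |(t : ℝ) - (t₀ : ℝ)| ^ α) (𝓝[≠] t₀) (𝓝 0) := by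
  refine squeeze_zero' (Eventually.of_forall fun t => by positivity) ?_ hβ
  have h1 : ∀ᶠ t in 𝓝[≠] t₀, dist t t₀ < 1 :=
    eventually_nhdsWithin_of_eventually_nhds (Metric.ball_mem_nhds t₀ one_pos)
  filter_upwards [h1, self_mem_nhdsWithin] with t ht hne
  have h0 : 0 < |(t : ℝ) - t₀| := by
    rw [← NNReal.dist_eq]
    exact dist_pos.2 hne
  rw [NNReal.dist_eq] at ht
  have := Real.rpow_pos_of_pos h0 β
  exact div_le_div_of_nonneg_left (abs_nonneg _) this
    (Real.rpow_le_rpow_of_exponent_ge h0 ht.le hαβ)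

lemma tendsto_div_rpow_of_dist_le {f : ℝ≥0 → ℝ} {t₀ : ℝ≥0} {C α γ : ℝ} (hαγ : α < γ)
    (hf : ∀ᶠ t in 𝓝 t₀, |f t - f t₀| ≤ C * |(t : ℝ) - t₀| ^ γ) :
    Tendsto (fun t : ℝ≥0 => |f t - f t₀| / |(t : ℝ) - (t₀ : ℝ)| ^ α) (𝓝[≠] t₀) (𝓝 0) := by
  have hd : Tendsto (fun t : ℝ≥0 => |(t : ℝ) - t₀|) (𝓝[≠] t₀) (𝓝 0) := by
    refine Tendsto.mono_left ?_ nhdsWithin_le_nhds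
    have : Continuous fun t : ℝ≥0 => |(t : ℝ) - t₀| := by fun_prop
    simpa using this.tendsto t₀
  have hlim : Tendsto (fun t : ℝ≥0 => C * |(t : ℝ) - t₀| ^ (γ - α)) (𝓝[≠] t₀) (𝓝 0) := by
    have := (hd.rpow_const (p := γ - α) (Or.inr (by linarith))).const_mul C
    rwa [Real.zero_rpow (by linarith), mul_zero] at this
  refine squeeze_zero' (Eventually.of_forall fun t => by positivity) ?_ hlim
  filter_upwards [eventually_nhdsWithin_of_eventually_nhds hf, self_mem_nhdsWithin] with t ht hne
  have h0 : 0 < |(t : ℝ) - t₀| := by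
    rw [← NNReal.dist_eq]
    exact dist_pos.2 hne
  rw [div_le_iff₀ (Real.rpow_pos_of_pos h0 α), mul_assoc, ← Real.rpow_add h0, sub_add_cancel]
  exact ht

/-- The admissible exponents are closed downwards, so rational ones decide. This leaves countably
many almost sure statements to intersect. -/
lemma pointwiseHolderExponent_eq {f : ℝ≥0 → ℝ} {t₀ : ℝ≥0} {x : ℝ}
    (hlt : ∀ q : ℚ, 0 ≤ q → (q : ℝ) < x →
      Tendsto (fun t : ℝ≥0 => |f t - f t₀| / |(t : ℝ) - (t₀ : ℝ)| ^ (q : ℝ)) (𝓝[≠] t₀) (𝓝 0))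
    (hgt : ∀ q : ℚ, x < q →
      ¬ Tendsto (fun t : ℝ≥0 => |f t - f t₀| / |(t : ℝ) - (t₀ : ℝ)| ^ (q : ℝ)) (𝓝[≠] t₀) (𝓝 0)) :
    pointwiseHolderExponent f t₀ = ENNReal.ofReal x := by
  refine le_antisymm (iSup₂_le fun α hα => ?_) (le_of_forall_lt fun y hy => ?_)
  · by_contra! hcon
    have hxα : x < α :=
      (Real.le_coe_toNNReal x).trans_lt (NNReal.coe_lt_coe.2 (ENNReal.coe_lt_coe.1 hcon))
    obtain ⟨q, hq1, hq2⟩ := exists_rat_btwn hxα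
    exact hgt q hq1 (tendsto_div_rpow_of_le hq2.le hα)
  · obtain ⟨q, hq0, hq1, hq2⟩ := ENNReal.lt_iff_exists_rat_btwn.1 hy
    have hqx : (q : ℝ) < x := by
      by_contra! hcon
      exact absurd hq2 (not_lt.2 (ENNReal.ofReal_le_ofReal hcon))
    refine hq1.trans_le ?_
    refine le_iSup₂_of_le (Real.toNNReal q) ?_ le_rfl
    rw [Real.coe_toNNReal _ (by exact_mod_cast hq0)]
    exact hlt q hq0 hqx

end HolderExponent

/-! ### The pointwise Hölder exponent of the process. -/

namespace IsMultifractionalLimit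

variable {Ω : Type*} [MeasurableSpace Ω] {P : Measure Ω} {a b c M : ℝ} {R : ℝ → ℝ → ℝ}
  {h : ℝ → ℝ} {S Y : ℝ≥0 → Ω → ℝ}

lemma ae_tendsto_div_rpow [IsFiniteMeasure P] (hS : IsMultifractionalLimit R h S P)
    (D : IsMultifractionalData a b c M R h) (hY : IsModification Y S P)
    (hYc : ∀ᵐ ω ∂P, Continuous fun t => Y t ω) (t₀ : ℝ≥0) {α : ℝ} (hα0 : 0 ≤ α) (hα : α < h t₀) :
    ∀ᵐ ω ∂P, Tendsto (fun t : ℝ≥0 => |Y t ω - Y t₀ ω| / |(t : ℝ) - (t₀ : ℝ)| ^ α)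
      (𝓝[≠] t₀) (𝓝 0) := by
  -- The choice is `max α (1/2) < H < h t₀`, then `α < γ < H`: tails need `γ < H`, and the gap `γ -
  -- α` sends the quotient to `0`.
  obtain ⟨H, hH1, hH2⟩ := exists_between
    (max_lt hα (D.half_lt.trans_le (D.mem t₀ t₀.coe_nonneg).1))
  obtain ⟨hH3, hH4⟩ := max_lt_iff.1 hH1
  obtain ⟨γ, hγ1, hγ2⟩ := exists_between hH3
  have hc : Continuous fun u : ℝ≥0 => h u :=
    D.continuousOn.comp_continuous NNReal.continuous_coe fun u => u.coe_nonneg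
  obtain ⟨A, B, -, hAB, hsub⟩ := exists_Icc_mem_subset_of_mem_nhds
    (hc.continuousAt.eventually_const_lt hH2)
  have hdy : ∀ᵐ ω ∂P, ∀ n k : ℕ, Y (k / 2 ^ n) ω = S (k / 2 ^ n) ω :=
    ae_all_iff.2 fun n => ae_all_iff.2 fun k => hY _
  filter_upwards [hYc, hdy, hS.ae_exists_dyadicIncrementsLE D hH4 hγ2
    (fun u hu => (hsub hu).le : ∀ u ∈ Icc A B, H ≤ h u)] with ω hcω hω ⟨n₀, hn₀⟩
  have hYn : DyadicIncrementsLE (fun t => Y t ω) A B ((1 / 2 : ℝ) ^ γ) n₀ := by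
    intro n hn k hA hB
    have h3 := hω n (k + 1)
    push_cast at h3
    simp only [hω n k, h3]
    exact hn₀ n hn k hA hB
  obtain ⟨C, hC⟩ := hYn.dist_limit_le (g := fun t => Y t ω) (hα0.trans_lt hγ1)
  have hlim : ∀ t, Tendsto (fun n => Y (dyadicFloor n t) ω) atTop (𝓝 (Y t ω)) := fun t =>
    (hcω.tendsto t).comp (tendsto_dyadicFloor t)
  refine tendsto_div_rpow_of_dist_le (f := fun t => Y t ω) (C := C) hγ1 ?_
  filter_upwards [eventually_mem_nhds_iff.2 hAB,
    Metric.ball_mem_nhds t₀ (by positivity : (0 : ℝ) < (1 / 2 : ℝ) ^ n₀)] with t ht htd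
  exact hC t t₀ (hlim t) (hlim t₀) ht hAB htd

lemma ae_not_tendsto_div_rpow [IsFiniteMeasure P] (hS : IsMultifractionalLimit R h S P)
    (D : IsMultifractionalData a b c M R h) (hY : IsModification Y S P) (t₀ : ℝ≥0) {α : ℝ}
    (hα : h t₀ < α) :
    ∀ᵐ ω ∂P, ¬ Tendsto (fun t : ℝ≥0 => |Y t ω - Y t₀ ω| / |(t : ℝ) - (t₀ : ℝ)| ^ α)
      (𝓝[≠] t₀) (𝓝 0) := by
  obtain ⟨H, hH1, hH2⟩ := exists_between hα
  have hc : Continuous fun u : ℝ≥0 => h u :=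
    D.continuousOn.comp_continuous NNReal.continuous_coe fun u => u.coe_nonneg
  obtain ⟨A, B, ht₀, hAB, hsub⟩ := exists_Icc_mem_subset_of_mem_nhds
    (hc.continuousAt.eventually_lt_const hH1)
  -- Increments to the right of `t₀` also serve `t₀ = 0`, and a sequence needs `Y = S` at countably
  -- many times only.
  set δ : ℕ → ℝ≥0 := fun n => 1 / (n + 1) with hδ
  have hδ0 : ∀ n, 0 < δ n := fun n => by positivity
  have hδ1 : ∀ n, δ n ≤ 1 := fun n => by
    rw [hδ]
    exact div_le_one_of_le₀ (by simp) (by positivity)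
  have hδlim : Tendsto δ atTop (𝓝 0) := tendsto_one_div_add_atTop_nhds_zero_nat
  have hδlim' : Tendsto (fun n => (δ n : ℝ)) atTop (𝓝 0) := by
    rw [← NNReal.coe_zero]
    exact NNReal.tendsto_coe.2 hδlim
  have htlim : Tendsto (fun n => t₀ + δ n) atTop (𝓝 t₀) := by
    simpa using hδlim.const_add t₀
  have hprob : Tendsto (fun n => P {ω | |S (t₀ + δ n) ω - S t₀ ω| ≤ (δ n : ℝ) ^ α}) atTop
      (𝓝 0) := by
    have hup : Tendsto (fun n => ENNReal.ofReal (2 / √c * (δ n : ℝ) ^ (α - H))) atTop (𝓝 0) := by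
      have := (hδlim'.rpow_const (p := α - H) (Or.inr (by linarith))).const_mul (2 / √c)
      rw [Real.zero_rpow (by linarith), mul_zero] at this
      simpa using ENNReal.tendsto_ofReal this
    refine tendsto_of_tendsto_of_tendsto_of_le_of_le' tendsto_const_nhds hup
      (Eventually.of_forall fun _ => zero_le) ?_
    filter_upwards [htlim hAB] with n hn
    have hx0 : (0 : ℝ) < δ n := hδ0 n
    have hv : c * (δ n : ℝ) ^ (2 * H) ≤ ∫ ω, (S (t₀ + δ n) ω - S t₀ ω) ^ 2 ∂P := by
      have := hS.le_integral_sub_sq D (s := t₀) (t := t₀ + δ n) (H := H)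
        (lt_add_of_pos_right _ (hδ0 n)) (by simpa using hδ1 n) (fun u hu => by
          lift u to ℝ≥0 using t₀.coe_nonneg.trans hu.1
          exact (hsub ⟨ht₀.1.trans (NNReal.coe_le_coe.1 hu.1),
            (NNReal.coe_le_coe.1 hu.2).trans hn.2⟩).le)
      simpa using this
    have hc0 := D.pos
    rw [← ofReal_measureReal]
    refine ENNReal.ofReal_le_ofReal
      (((hS.hasGaussianLaw_sub t₀ (t₀ + δ n)).measureReal_abs_le_le
        (hS.integral_sub_eq_zero t₀ (t₀ + δ n)) (by positivity) hv (by positivity)).trans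
        (le_of_eq ?_))
    have e : √(c * (δ n : ℝ) ^ (2 * H)) = √c * (δ n : ℝ) ^ H := by
      rw [Real.sqrt_mul hc0.le, mul_comm 2 H, Real.rpow_mul hx0.le, Real.rpow_two,
        Real.sqrt_sq (by positivity)]
    rw [e, Real.rpow_sub hx0]
    field_simp
  have hYS : ∀ᵐ ω ∂P, ∀ n, Y (t₀ + δ n) ω = S (t₀ + δ n) ω := ae_all_iff.2 fun n => hY _
  -- A quotient tending to `0` is eventually below `1`, so the path would eventually stay in the
  -- small-increment events.
  filter_upwards [ae_not_eventually_mem_of_tendsto_zero hprob, hYS, hY t₀] with ω h1 h2 h3 hlim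
  refine h1 ?_
  have htlim' : Tendsto (fun n => t₀ + δ n) atTop (𝓝[≠] t₀) := by
    refine tendsto_nhdsWithin_iff.2 ⟨htlim, Eventually.of_forall fun n => ?_⟩
    exact (lt_add_of_pos_right _ (hδ0 n)).ne'
  filter_upwards [(hlim.comp htlim').eventually_lt_const one_pos] with n hn
  have hx0 : (0 : ℝ) < δ n := hδ0 n
  simp only [Function.comp_apply, NNReal.coe_add, add_sub_cancel_left, h2, h3, NNReal.abs_eq] at hn
  rw [div_lt_one (by positivity)] at hn
  exact hn.le

theorem ae_pointwiseHolderExponent_eq [IsFiniteMeasure P] (hS : IsMultifractionalLimit R h S P)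
    (D : IsMultifractionalData a b c M R h) (hY : IsModification Y S P)
    (hYc : ∀ᵐ ω ∂P, Continuous fun t => Y t ω) (t₀ : ℝ≥0) :
    ∀ᵐ ω ∂P, pointwiseHolderExponent (fun t => Y t ω) t₀ = ENNReal.ofReal (h t₀) := by
  have hlt : ∀ᵐ ω ∂P, ∀ q : ℚ, 0 ≤ q → (q : ℝ) < h t₀ →
      Tendsto (fun t : ℝ≥0 => |Y t ω - Y t₀ ω| / |(t : ℝ) - (t₀ : ℝ)| ^ (q : ℝ))
        (𝓝[≠] t₀) (𝓝 0) := by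
    simp only [ae_all_iff]
    exact fun q hq0 hq => hS.ae_tendsto_div_rpow D hY hYc t₀ (by exact_mod_cast hq0) hq
  have hgt : ∀ᵐ ω ∂P, ∀ q : ℚ, h t₀ < q →
      ¬ Tendsto (fun t : ℝ≥0 => |Y t ω - Y t₀ ω| / |(t : ℝ) - (t₀ : ℝ)| ^ (q : ℝ))
        (𝓝[≠] t₀) (𝓝 0) := by
    simp only [ae_all_iff]
    exact fun q hq => hS.ae_not_tendsto_div_rpow D hY t₀ hq
  filter_upwards [hlt, hgt] with ω h1 h2
  exact pointwiseHolderExponent_eq h1 h2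

end IsMultifractionalLimit

theorem proposition2 {Ω' Ω : Type*} [MeasurableSpace Ω'] [MeasurableSpace Ω]
    (P' : Measure Ω') [IsProbabilityMeasure P'] (P : Measure Ω) [IsProbabilityMeasure P]
    (a b : ℝ) (ha : 1 / 2 < a) (hab : a ≤ b) (hb : b < 1)
    (X : ℕ → ℝ → Ω' → ℝ)
    (hX : IsCenteredGaussian (fun p : ℕ × Ioo (1 / 2 : ℝ) 1 => X p.1 p.2) P')
    (hXbdd : CovarianceBoundedNearDiagonal a b X P')
    (R : ℝ → ℝ → ℝ) (hR : HasAsymptoticCovariance a b X P' R)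
    (h : ℝ → ℝ) (hcont : ContinuousOn h (Ici 0)) (hmem : ∀ t, 0 ≤ t → h t ∈ Icc a b)
    (S : ℝ≥0 → Ω → ℝ) (hS : IsMultifractionalLimit R h S P) :
    (∃ Y : ℝ≥0 → Ω → ℝ, (∀ t, Measurable (Y t)) ∧ IsModification Y S P ∧
      ∀ ω, Continuous fun t => Y t ω) ∧
    ((∃ C r : ℝ≥0, 0 < r ∧ HolderOnWith C r h (Ici 0)) →
      ∀ Y : ℝ≥0 → Ω → ℝ, IsModification Y S P → (∀ᵐ ω ∂P, Continuous fun t => Y t ω) →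
        ∀ t₀ : ℝ≥0, ∀ᵐ ω ∂P,
          pointwiseHolderExponent (fun t => Y t ω) t₀ = ENNReal.ofReal (h t₀)) := by
  obtain ⟨c, M, D⟩ := IsMultifractionalData.exists_bounds ha hab hb hR.continuousOn hR.pos hcont
    hmem
  exact ⟨hS.exists_continuous_modification D,
    fun _ Y hY hYc t₀ => hS.ae_pointwiseHolderExponent_eq D hY hYc t₀⟩
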